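/- Let $X,Y\subset\mathbb{R}$ be nonempty compact sets, equipped with the Euclidean metric. Let $d_H$ denote the Hausdorff distance, let $d_{GH}(X,Y)$ denote the Gromov--Hausdorff distance of the metric spaces $X$ and $Y$ (the infimum of $d_H^Z(f(X),g(Y))$ over all metric spaces $Z$ and all distance-preserving maps $f:X\to Z$, $g:Y\to Z$), and let $$d_{H,iso}(X,Y)=\inf_{T} d_H(X,T(Y)),$$ where the infimum is over all distance-preserving maps $T:\mathbb{R}\to\mathbb{R}$. Then $$d_{H,iso}(X,Y)\le\frac{5}{4}\,d_{GH}(X,Y).$$ -/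

import Mathlib

/-- The Hausdorff distance up to Euclidean isometry of two subsets of the real line: the infimum
of `d_H(X, T(Y))` over all distance-preserving maps `T : ℝ → ℝ`. -/
noncomputable def hausdorffIsoDist (X Y : Set ℝ) : ℝ :=
  ⨅ T : {T : ℝ → ℝ // Isometry T}, Metric.hausdorffDist X (T.1 '' Y)

open Set Metric

/-! A correspondence of distortion at most 2δ between X and Y, written in u = (x + y)/2 and v = (x -
y)/2, is a planar family whose points are pairwise δ-close in u or in v, because ||a| - |b|| =
min(|a + b|, |a - b|). Translating Y amounts to matching the values of u + v with those of u - v up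
to a shift k; reflecting Y exchanges u and v. A point matches itself when |2v + k| ≤ 5δ/4; the
others are matched mainly with extreme points of the family.

If one coordinate has half-spread at most δ, `ShiftMatched.of_spread_le` applies. Otherwise
closeness forces the extreme points into a pinwheel. If the larger half-spread is at least 11δ/8,
shift 0 works (`Pinwheel.shiftMatched_of_le`); if not, some |k| ≤ δ/4 does
(`Pinwheel.shiftMatched_of_ge`). Nonzero shifts come from connectedness: points with v too high and
points with v too low cannot fail at the same k. -/

/-- Any two points of the family of planar points `(u i, v i)` are `δ`-close in one of the two
coordinates. -/
def PairwiseClose {ι : Type*} (u v : ι → ℝ) (δ : ℝ) : Prop :=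
  ∀ i j, |u i - u j| ≤ δ ∨ |v i - v j| ≤ δ

/-- After a shift by `k`, the sets of values of `u + v` and of `u - v` are `ρ`-close in the
Hausdorff sense. -/
def ShiftMatched {ι : Type*} (u v : ι → ℝ) (ρ : ℝ) : Prop :=
  ∃ k : ℝ, ∀ i, (∃ j, |u i + v i + k - (u j - v j)| ≤ ρ) ∧ ∃ j, |u i - v i - k - (u j + v j)| ≤ ρ

/-! ### Symmetries of the planar conditions -/

section
variable {ι : Type*} {u v : ι → ℝ} {δ ρ : ℝ}

lemma PairwiseClose.swap (h : PairwiseClose u v δ) : PairwiseClose v u δ :=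
  fun i j => (h i j).symm

lemma PairwiseClose.neg_left (h : PairwiseClose u v δ) : PairwiseClose (-u) v δ := by
  intro i j
  have e : (-u) i - (-u) j = -(u i - u j) := by simp only [Pi.neg_apply]; ring
  rw [e, abs_neg]
  exact h i j

lemma PairwiseClose.sub_const (h : PairwiseClose u v δ) (a b : ℝ) :
    PairwiseClose (fun i => u i - a) (fun i => v i - b) δ := by
  intro i j
  simpa using h i j

/-- Negating u turns u + v into -(u - v), so the two matching conditions trade places. -/
lemma ShiftMatched.of_neg_left (h : ShiftMatched (-u) v ρ) : ShiftMatched u v ρ := by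
  obtain ⟨k, hk⟩ := h
  refine ⟨k, fun i => ?_⟩
  obtain ⟨⟨j, hj⟩, l, hl⟩ := hk i
  refine ⟨⟨l, ?_⟩, j, ?_⟩
  · rw [← abs_neg]
    convert hl using 2
    simp only [Pi.neg_apply]; ring
  · rw [← abs_neg]
    convert hj using 2
    simp only [Pi.neg_apply]; ring

lemma ShiftMatched.of_sub_const {a b : ℝ}
    (h : ShiftMatched (fun i => u i - a) (fun i => v i - b) ρ) : ShiftMatched u v ρ := by
  obtain ⟨k, hk⟩ := h
  refine ⟨k - 2 * b, fun i => ?_⟩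
  obtain ⟨⟨j, hj⟩, l, hl⟩ := hk i
  refine ⟨⟨j, ?_⟩, l, ?_⟩
  · convert hj using 2
    ring
  · convert hl using 2
    ring

/-! ### Finding a shift by connectedness -/

/-- Intermediate value principle for shifts: if the points with large `v` are matched at shift `K`,
the points with small `v` at shift `-K`, and at no shift in between there are unmatched points of
both kinds, then some shift matches all points. -/
lemma ShiftMatched.of_no_simultaneous_failure [TopologicalSpace ι] [CompactSpace ι]
    (hu : Continuous u) (hv : Continuous v) {K : ℝ} (hK : 0 ≤ K)
    (hi : ∀ i, ρ < 2 * v i + K → (∃ j, |u i + v i + K - (u j - v j)| ≤ ρ) ∧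
      ∃ j, |u i - v i - K - (u j + v j)| ≤ ρ)
    (lo : ∀ i, 2 * v i - K < -ρ → (∃ j, |u i + v i - K - (u j - v j)| ≤ ρ) ∧
      ∃ j, |u i - v i + K - (u j + v j)| ≤ ρ)
    (no : ∀ k, -K ≤ k → k ≤ K → ∀ i j, ρ < 2 * v i + k → 2 * v j + k < -ρ →
      ((∀ l, ρ < |u i + v i + k - (u l - v l)|) ∨ ∀ l, ρ < |u i - v i - k - (u l + v l)|) →
      ((∀ l, ρ < |u j + v j + k - (u l - v l)|) ∨ ∀ l, ρ < |u j - v j - k - (u l + v l)|) →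
      False) :
    ShiftMatched u v ρ := by
  -- Projection along the compact `ι` is a closed map, so being matched is a closed condition on k.
  have key : ∀ f : ι → ℝ → ℝ, (Continuous fun p : ι × ℝ => f p.1 p.2) →
      IsClosed {k | ∃ j, |f j k| ≤ ρ} := by
    intro f hf
    have h1 : IsClosed {p : ι × ℝ | |f p.1 p.2| ≤ ρ} := isClosed_le hf.abs continuous_const
    have h2 := isClosedMap_snd_of_compactSpace _ h1
    convert h2 using 1
    ext k
    simp
  let M : ι → Set ℝ := fun i => {k | ∃ j, |u i + v i + k - (u j - v j)| ≤ ρ} ∩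
    {k | ∃ j, |u i - v i - k - (u j + v j)| ≤ ρ}
  have hM : ∀ i, IsClosed (M i) := fun i =>
    (key (fun j k => u i + v i + k - (u j - v j)) (by fun_prop)).inter
      (key (fun j k => u i - v i - k - (u j + v j)) (by fun_prop))
  let A : Set ℝ := ⋂ i, (M i ∪ {k | 2 * v i + k ≤ ρ})
  let B : Set ℝ := ⋂ i, (M i ∪ {k | -ρ ≤ 2 * v i + k})
  have hA : IsClosed A := isClosed_iInter fun i => (hM i).union
    (isClosed_le (by fun_prop) continuous_const)
  have hB : IsClosed B := isClosed_iInter fun i => (hM i).union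
    (isClosed_le continuous_const (by fun_prop))
  have hnot : ∀ i k, k ∉ M i → (∀ l, ρ < |u i + v i + k - (u l - v l)|) ∨
      ∀ l, ρ < |u i - v i - k - (u l + v l)| := by
    intro i k h
    by_contra! hc
    exact h hc
  have hcov : Icc (-K) K ⊆ A ∪ B := by
    intro k hk
    by_contra hc
    simp only [A, B, mem_union, mem_iInter, mem_ofPred_eq, not_or, not_forall, not_le] at hc
    obtain ⟨⟨i, hi1, hi2⟩, j, hj1, hj2⟩ := hc
    exact no k hk.1 hk.2 i j hi2 hj2 (hnot i k hi1) (hnot j k hj1)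
  obtain ⟨k, -, hkA, hkB⟩ := isPreconnected_closed_iff.1 (isPreconnected_Icc (a := -K) (b := K))
    A B hA hB hcov
    ⟨K, ⟨by linarith, le_rfl⟩, by
      simp only [A, mem_iInter]
      intro i
      by_cases h : 2 * v i + K ≤ ρ
      · exact Or.inr h
      · exact Or.inl (hi i (not_le.1 h))⟩
    ⟨-K, ⟨le_rfl, by linarith⟩, by
      simp only [B, mem_iInter]
      intro i
      by_cases h : -ρ ≤ 2 * v i + -K
      · exact Or.inr h
      · refine Or.inl ?_
        have := lo i (by linarith)
        simpa only [M, mem_inter_iff, mem_ofPred_eq, ← sub_eq_add_neg, sub_neg_eq_add] using this⟩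
  refine ⟨k, fun i => ?_⟩
  simp only [A, B, mem_iInter] at hkA hkB
  rcases hkA i with h | h
  · exact h
  rcases hkB i with h' | h'
  · exact h'
  have h1 : 2 * v i + k ≤ ρ := h
  have h2 : -ρ ≤ 2 * v i + k := h'
  -- Here |2v + k| ≤ ρ, so the point is matched with itself.
  refine ⟨⟨i, ?_⟩, i, ?_⟩ <;> rw [abs_le] <;> constructor <;> linarith

/-- At the end shifts, high points are matched with the lowest point `R` and low ones with the
highest point `S`: such pairs are far apart in v, hence δ-close in u. -/
lemma ShiftMatched.of_spread_le [TopologicalSpace ι] [CompactSpace ι]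
    (hu : Continuous u) (hv : Continuous v) (hδ : 0 ≤ δ) (h : PairwiseClose u v δ)
    {β : ℝ} (hβ : β ≤ δ) {R S : ι} (hR : v R = -β) (hS : v S = β)
    (hlo : ∀ i, -β ≤ v i) (hup : ∀ i, v i ≤ β) : ShiftMatched u v (5 / 4 * δ) := by
  simp only [PairwiseClose, abs_le] at h
  have hβ0 : -β ≤ β := hR ▸ hup R
  -- Matching a point with 2v > 5δ/4 - K to `R` at shift K needs K ≥ 2β - 7δ/4 for the lower bound
  -- and K ≤ δ/4 for the upper one; β ≤ δ makes these compatible.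
  obtain ⟨K, hK0, hK1, hK2⟩ : ∃ K, 0 ≤ K ∧ 2 * β - 7 / 4 * δ ≤ K ∧ (K = 0 ∨ K = 2 * β - 7 / 4 * δ) := by
    rcases le_total (2 * β - 7 / 4 * δ) 0 with h' | h'
    · exact ⟨0, le_rfl, h', Or.inl rfl⟩
    · exact ⟨_, h', le_rfl, Or.inr rfl⟩
  have hK3 : K ≤ δ / 4 := by rcases hK2 with h' | h' <;> linarith
  apply ShiftMatched.of_no_simultaneous_failure hu hv hK0
  · intro i hi
    have b1 := hlo i
    have b2 := hup i
    have c := h i R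
    rw [hR] at c
    refine ⟨⟨R, ?_⟩, R, ?_⟩ <;> rw [abs_le, hR] <;>
      rcases hK2 with h' | h' <;> rcases c with c | c <;> constructor <;> linarith
  · intro i hi
    have b1 := hlo i
    have b2 := hup i
    have c := h i S
    rw [hS] at c
    refine ⟨⟨S, ?_⟩, S, ?_⟩ <;> rw [abs_le, hS] <;>
      rcases hK2 with h' | h' <;> rcases c with c | c <;> constructor <;> linarith
  · intro k hk1 hk2 i j hi hj ui uj
    have bi1 := hlo i
    have bi2 := hup i
    have bj1 := hlo j
    have bj2 := hup j
    -- These four pairs are more than δ apart in v, hence δ-close in u; the rest is linear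
    -- arithmetic with the candidates `i`, `j`, `R`, `S`.
    have cij : -δ ≤ u i - u j ∧ u i - u j ≤ δ := by
      rcases h i j with c | c
      · exact c
      · exfalso; linarith
    have ciR : -δ ≤ u i - u R ∧ u i - u R ≤ δ := by
      rcases h i R with c | c
      · exact c
      · exfalso; rw [hR] at c; rcases hK2 with h' | h' <;> linarith
    have cjS : -δ ≤ u j - u S ∧ u j - u S ≤ δ := by
      rcases h j S with c | c
      · exact c
      · exfalso; rw [hS] at c; rcases hK2 with h' | h' <;> linarith
    have cRS : -δ ≤ u R - u S ∧ u R - u S ≤ δ := by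
      rcases h R S with c | c
      · exact c
      · exfalso; rw [hS, hR] at c; rcases hK2 with h' | h' <;> linarith
    simp only [lt_abs] at ui uj
    rcases ui with ui | ui <;> rcases uj with uj | uj
    · rcases ui j with a | a <;> rcases uj i with b | b <;>
        rcases hK2 with h' | h' <;> linarith
    · have aR := ui R
      have aS := ui S
      have bS := uj S
      have a := ui j
      rw [hR] at aR
      rw [hS] at aS bS
      rcases hK2 with h' | h' <;> rcases aR with aR | aR <;> try linarith
      all_goals rcases aS with aS | aS <;> try linarith
      all_goals rcases bS with bS | bS <;> try linarith
      all_goals rcases a with a | a <;> linarith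
    · have aR := ui R
      have aS := ui S
      have bS := uj S
      have a := ui j
      rw [hR] at aR
      rw [hS] at aS bS
      rcases hK2 with h' | h' <;> rcases aR with aR | aR <;> try linarith
      all_goals rcases aS with aS | aS <;> try linarith
      all_goals rcases bS with bS | bS <;> try linarith
      all_goals rcases a with a | a <;> linarith
    · rcases ui j with a | a <;> rcases uj i with b | b <;>
        rcases hK2 with h' | h' <;> linarith
-- The pinwheel
/-- The pinwheel configuration of extreme points: the family is contained in
`[-α, α] × [-β, β]` with both side lengths greater than `2 * δ`, and touches the sides at `P`, `Q`,
`R` and `S`. -/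
structure Pinwheel (u v : ι → ℝ) (δ α β : ℝ) (P Q R S : ι) : Prop where
  close : PairwiseClose u v δ
  nonneg : 0 ≤ δ
  lt_left : δ < α
  lt_right : δ < β
  u_P : u P = -α
  u_Q : u Q = α
  v_R : v R = -β
  v_S : v S = β
  neg_le_u : ∀ i, -α ≤ u i
  u_le : ∀ i, u i ≤ α
  neg_le_v : ∀ i, -β ≤ v i
  v_le : ∀ i, v i ≤ β
  le_v_P : β - δ ≤ v P
  v_Q_le : v Q ≤ δ - β
  u_R_le : u R ≤ δ - α
  le_u_S : α - δ ≤ u S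

namespace Pinwheel
variable {α β : ℝ} {P Q R S : ι}

lemma v_P_le (h : Pinwheel u v δ α β P Q R S) : v P ≤ v Q + δ := by
  have := h.u_P; have := h.u_Q; have := h.lt_left; have := h.nonneg
  rcases h.close P Q with c | c <;> rw [abs_le] at c <;> linarith

lemma u_S_le (h : Pinwheel u v δ α β P Q R S) : u S ≤ u R + δ := by
  have := h.v_R; have := h.v_S; have := h.lt_right; have := h.nonneg
  rcases h.close S R with c | c <;> rw [abs_le] at c <;> linarith

/-- Every point lies in the middle box or in one of the four arms of the pinwheel. -/
lemma trichotomy (h : Pinwheel u v δ α β P Q R S) (i : ι) :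
    (u i ≤ u S - δ ∧ β - δ ≤ v i ∧ v i ≤ v Q + δ ∧ u R - δ ≤ u i) ∨
    (u R + δ ≤ u i ∧ v i ≤ δ - β ∧ v P - δ ≤ v i ∧ u i ≤ u S + δ) ∨
    (u S - δ ≤ u i ∧ u i ≤ u R + δ ∧
      ((v Q + δ ≤ v i ∧ α - δ ≤ u i) ∨ (v i ≤ v P - δ ∧ u i ≤ δ - α) ∨
        (v P - δ ≤ v i ∧ v i ≤ v Q + δ))) := by
  obtain ⟨hc, h0, h1, h2, h3, h4, h5, h6, h7, h8, h9, h10, h11, h12, h13, h14⟩ := h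
  have cP := hc i P
  have cQ := hc i Q
  have cR := hc i R
  have cS := hc i S
  have c1 := hc P Q
  have c2 := hc R S
  have a1 := h7 i
  have a2 := h8 i
  have a3 := h9 i
  have a4 := h10 i
  simp only [abs_le] at *
  rw [h3] at cP; rw [h4] at cQ; rw [h5] at cR; rw [h6] at cS
  clear hc h7 h8 h9 h10
  grind

/-- Only the middle box can escape both `R` and `S`; there v P - δ ≤ v ≤ v Q + δ, which gives |v| ≤
2δ - β. -/
lemma x_matched (h : Pinwheel u v δ α β P Q R S) (i : ι) :
    |u i + v i - (u R - v R)| ≤ δ ∨ |u i + v i - (u S - v S)| ≤ δ ∨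
      (|v i| ≤ 2 * δ - β ∧ u S - v S + δ < u i + v i ∧ u i + v i < u R - v R - δ) := by
  have e1 := h.v_P_le
  have e2 := h.u_S_le
  have t := h.trichotomy i
  obtain ⟨hc, h0, h1, h2, h3, h4, h5, h6, h7, h8, h9, h10, h11, h12, h13, h14⟩ := h
  have a1 := h7 i
  have a2 := h8 i
  have a3 := h9 i
  have a4 := h10 i
  rw [h5, h6]
  simp only [abs_le]
  clear hc h7 h8 h9 h10
  rcases t with t | t | ⟨t1, t2, t | t | t⟩
  · right; left; constructor <;> linarith
  · left; constructor <;> linarith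
  · left; constructor <;> linarith
  · right; left; constructor <;> linarith
  · by_cases g1 : u i + v i ≤ u S - β + δ
    · right; left; constructor <;> linarith
    by_cases g2 : u R - -β - δ ≤ u i + v i
    · left; constructor <;> linarith
    right; right; refine ⟨⟨?_, ?_⟩, ?_, ?_⟩ <;> linarith

/-- The side arms go to `R` and `S`. So do values in the central strip lying more than δ outside
those of `P` and `Q`; values within δ of these go to `P` or `Q`. -/
lemma z_matched (h : Pinwheel u v δ α β P Q R S) (i : ι) :
    (∃ j, |u i - v i - (u j + v j)| ≤ δ) ∨
      (u S - δ ≤ u i ∧ u i ≤ u R + δ ∧ u P + v P + δ < u i - v i ∧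
        u i - v i < u Q + v Q - δ) := by
  have e1 := h.v_P_le
  have e2 := h.u_S_le
  have t := h.trichotomy i
  obtain ⟨hc, h0, h1, h2, h3, h4, h5, h6, h7, h8, h9, h10, h11, h12, h13, h14⟩ := h
  have a1 := h7 i
  have a2 := h8 i
  have a3 := h9 i
  have a4 := h10 i
  clear hc h7 h8 h9 h10
  rcases t with t | t | ⟨t1, t2, -⟩
  · exact Or.inl ⟨R, by rw [abs_le, h5]; constructor <;> linarith⟩
  · exact Or.inl ⟨S, by rw [abs_le, h6]; constructor <;> linarith⟩
  · by_cases g1 : u i - v i < u P + v P - δ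
    · exact Or.inl ⟨R, by rw [abs_le, h5]; constructor <;> linarith⟩
    by_cases g2 : u Q + v Q + δ < u i - v i
    · exact Or.inl ⟨S, by rw [abs_le, h6]; constructor <;> linarith⟩
    by_cases g3 : u i - v i ≤ u P + v P + δ
    · exact Or.inl ⟨P, by rw [abs_le]; constructor <;> linarith⟩
    by_cases g4 : u Q + v Q - δ ≤ u i - v i
    · exact Or.inl ⟨Q, by rw [abs_le]; constructor <;> linarith⟩
    right; refine ⟨t1, t2, ?_, ?_⟩ <;> linarith

/-- At shift 0 a point left over by `x_matched` is matched with itself: 2|v| ≤ 4δ - 2β ≤ 5δ/4, which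
is where 11/8 comes from. Nothing is left over by `z_matched`, since u + v grows from `P` to `Q` by
at most 2α - 2(β - δ) ≤ 2δ. -/
lemma shiftMatched_of_le (h : Pinwheel u v δ α β P Q R S) (hαβ : α ≤ β) (hβ : 11 / 8 * δ ≤ β) :
    ShiftMatched u v (5 / 4 * δ) := by
  refine ⟨0, fun i => ⟨?_, ?_⟩⟩
  · rcases h.x_matched i with m | m | m
    · exact ⟨R, by rw [abs_le] at *; constructor <;> linarith [h.nonneg]⟩
    · exact ⟨S, by rw [abs_le] at *; constructor <;> linarith [h.nonneg]⟩
    · exact ⟨i, by rw [abs_le] at *; constructor <;> linarith [h.nonneg]⟩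
  · rcases h.z_matched i with ⟨j, m⟩ | m
    · exact ⟨j, by rw [abs_le] at *; constructor <;> linarith [h.nonneg]⟩
    · exact ⟨P, by
        rw [abs_le]
        constructor <;> linarith [h.nonneg, h.u_P, h.u_Q, h.le_v_P, h.v_Q_le]⟩

/-- The values of u - v at `S` and `R` are at most 2δ + 2β - 2α ≤ 2δ apart, so `R` and `S` serve
every u + v whenever |k| ≤ δ/4. Only values of u - v in the central strip can fail. -/
lemma shiftMatched_of_ge [TopologicalSpace ι] [CompactSpace ι] (hu : Continuous u)
    (hv : Continuous v) (h : Pinwheel u v δ α β P Q R S) (hβα : β ≤ α) (hα : α ≤ 11 / 8 * δ) :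
    ShiftMatched u v (5 / 4 * δ) := by
  have h0 := h.nonneg
  have hP := h.u_P
  have hQ := h.u_Q
  have hP' := h.le_v_P
  have hQ' := h.v_Q_le
  have hR := h.u_R_le
  have hS := h.le_u_S
  have hβ := h.lt_right
  have hx : ∀ k, -(δ / 4) ≤ k → k ≤ δ / 4 → ∀ i,
      ∃ j, |u i + v i + k - (u j - v j)| ≤ 5 / 4 * δ := by
    intro k hk1 hk2 i
    rcases h.x_matched i with m | m | m
    · exact ⟨R, by rw [abs_le] at *; constructor <;> linarith⟩
    · exact ⟨S, by rw [abs_le] at *; constructor <;> linarith⟩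
    · by_cases hc : u i + v i + k ≤ u S - v S + 5 / 4 * δ
      · exact ⟨S, by rw [abs_le]; constructor <;> linarith⟩
      · exact ⟨R, by
          rw [abs_le]; constructor <;> linarith [h.v_R, h.v_S, h.u_S_le]⟩
  have hz : ∀ k, -(δ / 4) ≤ k → k ≤ δ / 4 → ∀ i,
      (∃ j, |u i - v i - k - (u j + v j)| ≤ 5 / 4 * δ) ∨
      (u S - δ ≤ u i ∧ u i ≤ u R + δ ∧ u P + v P + 5 / 4 * δ < u i - v i - k ∧
        u i - v i - k < u Q + v Q - 5 / 4 * δ) := by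
    intro k hk1 hk2 i
    rcases h.z_matched i with ⟨j, m⟩ | m
    · exact Or.inl ⟨j, by rw [abs_le] at *; constructor <;> linarith⟩
    · by_cases g1 : u i - v i - k ≤ u P + v P + 5 / 4 * δ
      · exact Or.inl ⟨P, by rw [abs_le]; constructor <;> linarith⟩
      by_cases g2 : u Q + v Q - 5 / 4 * δ ≤ u i - v i - k
      · exact Or.inl ⟨Q, by rw [abs_le]; constructor <;> linarith⟩
      right; refine ⟨m.1, m.2.1, ?_, ?_⟩ <;> linarith
  refine ShiftMatched.of_no_simultaneous_failure hu hv (K := δ / 4) (by linarith) ?_ ?_ ?_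
  · intro i hi
    refine ⟨hx _ (by linarith) le_rfl i, ?_⟩
    rcases hz (δ / 4) (by linarith) le_rfl i with m | m
    · exact m
    -- Here v > δ/2 and β > δ force u > 2δ - α, against u ≤ u R + δ ≤ 2δ - α.
    · exfalso; linarith
  · intro i hi
    refine ⟨by simpa only [← sub_eq_add_neg] using hx _ le_rfl (by linarith) i, ?_⟩
    rcases hz (-(δ / 4)) le_rfl (by linarith) i with m | m
    · simpa only [sub_neg_eq_add] using m
    · exfalso; linarith
  · intro k hk1 hk2 i j hi hj ui uj
    have fx : ∀ i, ¬ ∀ l, 5 / 4 * δ < |u i + v i + k - (u l - v l)| := by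
      intro i hc
      obtain ⟨l, hl⟩ := hx k hk1 hk2 i
      exact (hc l).not_ge hl
    replace ui := ui.resolve_left (fx i)
    replace uj := uj.resolve_left (fx j)
    have mi := (hz k hk1 hk2 i).resolve_left fun ⟨l, hl⟩ => (ui l).not_ge hl
    have mj := (hz k hk1 hk2 j).resolve_left fun ⟨l, hl⟩ => (uj l).not_ge hl
    -- The two failures give u i - u j > 7δ/4 - 2(α - β) > δ, by α ≤ 11δ/8 and β > δ, while v i - v
    -- j > 5δ/4.
    rcases h.close i j with c | c <;> rw [abs_le] at c <;> linarith

end Pinwheel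

/-! ### Assembling the cases -/

/-- The four extreme points of a family that is spread by more than `2 * δ` in both directions form
a pinwheel, up to a reflection. -/
lemma PairwiseClose.pinwheel_or {α β : ℝ} {P Q R S : ι} (h : PairwiseClose u v δ) (hδ : 0 ≤ δ)
    (hα : δ < α) (hβ : δ < β) (hP : u P = -α) (hQ : u Q = α) (hR : v R = -β) (hS : v S = β)
    (u1 : ∀ i, -α ≤ u i) (u2 : ∀ i, u i ≤ α) (v1 : ∀ i, -β ≤ v i) (v2 : ∀ i, v i ≤ β) :
    Pinwheel u v δ α β P Q R S ∨ Pinwheel (-u) v δ α β Q P R S := by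
  have hPS := h P S
  have hQS := h Q S
  have hPR := h P R
  have hQR := h Q R
  rw [hP, hS] at hPS
  rw [hQ, hS] at hQS
  rw [hP, hR] at hPR
  rw [hQ, hR] at hQR
  simp only [abs_le] at hPS hQS hPR hQR
  by_cases hp : β - δ ≤ v P
  · left
    -- Since β > δ, `P` cannot be v-close to both `S` and `R`; each such exclusion forces the next
    -- one around the rectangle.
    have hr : u R ≤ δ - α := by rcases hPR with c | c <;> linarith
    have hq : v Q ≤ δ - β := by rcases hQR with c | c <;> linarith
    have hs : α - δ ≤ u S := by rcases hQS with c | c <;> linarith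
    exact ⟨h, hδ, hα, hβ, hP, hQ, hR, hS, u1, u2, v1, v2, hp, hq, hr, hs⟩
  · right
    have hs : u S ≤ δ - α := by rcases hPS with c | c <;> linarith
    have hq : β - δ ≤ v Q := by rcases hQS with c | c <;> linarith
    have hr : α - δ ≤ u R := by rcases hQR with c | c <;> linarith
    have hp : v P ≤ δ - β := by rcases hPR with c | c <;> linarith
    refine ⟨h.neg_left, hδ, hα, hβ, ?_, ?_, hR, hS, fun i => ?_, fun i => ?_, v1, v2, hq, hp, ?_, ?_⟩
    · simp [hQ]
    · simp [hP]
    · simpa using u2 i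
    · simpa using neg_le.1 (u1 i)
    · simp only [Pi.neg_apply]; linarith
    · simp only [Pi.neg_apply]; linarith

lemma PairwiseClose.shiftMatched_of_spread_gt [TopologicalSpace ι] [CompactSpace ι]
    (hu : Continuous u) (hv : Continuous v) {α β : ℝ} {P Q R S : ι} (h : PairwiseClose u v δ)
    (hδ : 0 ≤ δ) (hα : δ < α) (hβ : δ < β) (hP : u P = -α) (hQ : u Q = α) (hR : v R = -β)
    (hS : v S = β) (u1 : ∀ i, -α ≤ u i) (u2 : ∀ i, u i ≤ α) (v1 : ∀ i, -β ≤ v i)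
    (v2 : ∀ i, v i ≤ β) (hαβ : α ≤ β ∧ 11 / 8 * δ ≤ β ∨ β ≤ α ∧ α ≤ 11 / 8 * δ) :
    ShiftMatched u v (5 / 4 * δ) := by
  rcases h.pinwheel_or hδ hα hβ hP hQ hR hS u1 u2 v1 v2 with hw | hw
  · rcases hαβ with c | c
    · exact hw.shiftMatched_of_le c.1 c.2
    · exact hw.shiftMatched_of_ge hu hv c.1 c.2
  · apply ShiftMatched.of_neg_left
    rcases hαβ with c | c
    · exact hw.shiftMatched_of_le c.1 c.2
    · exact hw.shiftMatched_of_ge hu.neg hv c.1 c.2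

/-- A family whose pairs are `δ`-close in one of the two coordinates is matched up to `5 / 4 * δ`
either directly or after exchanging the coordinates. -/
theorem PairwiseClose.shiftMatched_or [TopologicalSpace ι] [CompactSpace ι] [Nonempty ι]
    (hu : Continuous u) (hv : Continuous v) (hδ : 0 ≤ δ) (h : PairwiseClose u v δ) :
    ShiftMatched u v (5 / 4 * δ) ∨ ShiftMatched v u (5 / 4 * δ) := by
  have ext : ∀ w : ι → ℝ, Continuous w → ∃ c r : ℝ, ∃ A B : ι, w A - c = -r ∧ w B - c = r ∧
      (∀ i, -r ≤ w i - c) ∧ ∀ i, w i - c ≤ r := by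
    intro w hw
    obtain ⟨A, -, hA⟩ := isCompact_univ.exists_isMinOn univ_nonempty hw.continuousOn
    obtain ⟨B, -, hB⟩ := isCompact_univ.exists_isMaxOn univ_nonempty hw.continuousOn
    refine ⟨(w A + w B) / 2, (w B - w A) / 2, A, B, by ring, by ring, fun i => ?_, fun i => ?_⟩
    · have : w A ≤ w i := hA (mem_univ i)
      linarith
    · have : w i ≤ w B := hB (mem_univ i)
      linarith
  obtain ⟨a, α, P, Q, hP, hQ, u1, u2⟩ := ext u hu
  obtain ⟨b, β, R, S, hR, hS, v1, v2⟩ := ext v hv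
  suffices H : ShiftMatched (fun i => u i - a) (fun i => v i - b) (5 / 4 * δ) ∨
      ShiftMatched (fun i => v i - b) (fun i => u i - a) (5 / 4 * δ) from
    H.imp ShiftMatched.of_sub_const ShiftMatched.of_sub_const
  replace h := h.sub_const a b
  replace hu : Continuous fun i => u i - a := by fun_prop
  replace hv : Continuous fun i => v i - b := by fun_prop
  rcases le_or_gt β δ with hβ | hβ
  · exact Or.inl (.of_spread_le hu hv hδ h hβ hR hS v1 v2)
  rcases le_or_gt α δ with hα | hα
  · exact Or.inr (.of_spread_le hv hu hδ h.swap hα hP hQ u1 u2)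
  have direct := h.shiftMatched_of_spread_gt hu hv hδ hα hβ hP hQ hR hS u1 u2 v1 v2
  have swapped := h.swap.shiftMatched_of_spread_gt hv hu hδ hβ hα hR hS hP hQ v1 v2 u1 u2
  -- The coordinate of larger half-spread takes the role of v when that half-spread is at least
  -- 11δ/8, and of u otherwise.
  rcases le_total α β with hαβ | hαβ <;> rcases le_total (11 / 8 * δ) α with c | c <;>
    rcases le_total (11 / 8 * δ) β with d | d
  · exact Or.inl (direct (Or.inl ⟨hαβ, d⟩))
  · exact Or.inr (swapped (Or.inr ⟨hαβ, d⟩))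
  · exact Or.inl (direct (Or.inl ⟨hαβ, d⟩))
  · exact Or.inr (swapped (Or.inr ⟨hαβ, d⟩))
  · exact Or.inr (swapped (Or.inl ⟨hαβ, c⟩))
  · exact Or.inr (swapped (Or.inl ⟨hαβ, c⟩))
  · exact Or.inl (direct (Or.inr ⟨hαβ, c⟩))
  · exact Or.inl (direct (Or.inr ⟨hαβ, c⟩))

end

/-! ### From planar families back to subsets of the line -/

lemma hausdorffIsoDist_le_of_isometry (X Y : Set ℝ) {T : ℝ → ℝ} (hT : Isometry T) {r : ℝ}
    (h : hausdorffDist X (T '' Y) ≤ r) : hausdorffIsoDist X Y ≤ r :=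
  (ciInf_le (f := fun T : {T : ℝ → ℝ // Isometry T} => hausdorffDist X (T.1 '' Y))
    ⟨0, by rintro _ ⟨T, rfl⟩; exact hausdorffDist_nonneg⟩ ⟨T, hT⟩).trans h

/-- A total correspondence between `X` and `Y`, given as a family of pairs `(x i, y i)`, whose
graph is matched after a shift bounds the Hausdorff distance up to isometry. -/
lemma ShiftMatched.hausdorffIsoDist_le {ι : Type*} {u v x y : ι → ℝ} {ρ s : ℝ} {X Y : Set ℝ}
    (hρ : 0 ≤ ρ) (h : ShiftMatched u v ρ) (hX : range x = X) (hY : range y = Y)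
    (hs : ∀ t, |s * t| = |t|) (hx : ∀ i, u i + v i = x i) (hy : ∀ i, u i - v i = s * y i) :
    hausdorffIsoDist X Y ≤ ρ := by
  obtain ⟨k, hk⟩ := h
  subst hX hY
  simp only [hx, hy] at hk
  refine hausdorffIsoDist_le_of_isometry _ _ (T := fun t => s * t - k) ?_ ?_
  · refine Isometry.of_dist_eq fun a b => ?_
    rw [Real.dist_eq, Real.dist_eq, ← hs (a - b)]
    congr 1; ring
  · apply hausdorffDist_le_of_mem_dist hρ
    · rintro _ ⟨i, rfl⟩
      obtain ⟨j, hj⟩ := (hk i).1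
      refine ⟨_, ⟨y j, ⟨j, rfl⟩, rfl⟩, ?_⟩
      rw [Real.dist_eq]
      convert hj using 2
      ring
    · rintro _ ⟨_, ⟨i, rfl⟩, rfl⟩
      obtain ⟨j, hj⟩ := (hk i).2
      refine ⟨x j, ⟨j, rfl⟩, ?_⟩
      rw [Real.dist_eq]
      exact hj

lemma exists_dist_le_hausdorffDist {Z : Type*} [PseudoMetricSpace Z] {A B : Set Z}
    (hA : IsCompact A) (hB : IsCompact B) (hB' : B.Nonempty) {a : Z} (ha : a ∈ A) :
    ∃ b ∈ B, dist a b ≤ hausdorffDist A B := by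
  obtain ⟨b, hb, h⟩ := hB.exists_infDist_eq_dist hB' a
  refine ⟨b, hb, h ▸ infDist_le_hausdorffDist_of_mem ha ?_⟩
  exact hausdorffEDist_ne_top_of_nonempty_of_bounded ⟨a, ha⟩ hB' hA.isBounded hB.isBounded

/-- Points at distance at most `δ` in a common ambient space define a correspondence of distortion
at most `2 * δ`, expressed in the coordinates `(x + y) / 2` and `(x - y) / 2`. -/
lemma pairwiseClose_of_isometry {X Y : Set ℝ} {Z : Type*} [PseudoMetricSpace Z] {Φ : X → Z}
    {Ψ : Y → Z} (hΦ : Isometry Φ) (hΨ : Isometry Ψ) (δ : ℝ) :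
    PairwiseClose (fun p : {p : X × Y // dist (Φ p.1) (Ψ p.2) ≤ δ} => ((p.1.1 : ℝ) + p.1.2) / 2)
      (fun p => ((p.1.1 : ℝ) - p.1.2) / 2) δ := by
  rintro ⟨⟨a, b⟩, h⟩ ⟨⟨a', b'⟩, h'⟩
  have h1 := dist_triangle4 (Φ a) (Ψ b) (Ψ b') (Φ a')
  have h2 := dist_triangle4 (Ψ b) (Φ a) (Φ a') (Ψ b')
  rw [dist_comm (Ψ b') (Φ a'), hΦ.dist_eq, hΨ.dist_eq] at h1
  rw [dist_comm (Ψ b) (Φ a), hΦ.dist_eq, hΨ.dist_eq] at h2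
  rw [Subtype.dist_eq, Subtype.dist_eq, Real.dist_eq, Real.dist_eq] at h1 h2
  simp only at h h' ⊢
  rw [abs_le, abs_le]
  -- Increments of equal sign give closeness of the half-differences, of opposite sign closeness of
  -- the half-sums.
  rcases abs_cases ((a : ℝ) - a') with ⟨e, -⟩ | ⟨e, -⟩ <;>
    rcases abs_cases ((b : ℝ) - b') with ⟨f, -⟩ | ⟨f, -⟩ <;> rw [e, f] at h1 h2
  · right; constructor <;> linarith
  · left; constructor <;> linarith
  · left; constructor <;> linarith
  · right; constructor <;> linarith

/-- Two compact subsets of the line that embed isometrically into a common space at Hausdorff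
distance `δ` are at Hausdorff distance at most `5 / 4 * δ` up to isometries of the line. -/
theorem hausdorffIsoDist_le_of_isometry_hausdorffDist {X Y : Set ℝ} (hXc : IsCompact X)
    (hYc : IsCompact Y) (hXn : X.Nonempty) (hYn : Y.Nonempty) {Z : Type*} [PseudoMetricSpace Z]
    {Φ : X → Z} {Ψ : Y → Z} (hΦ : Isometry Φ) (hΨ : Isometry Ψ) :
    hausdorffIsoDist X Y ≤ 5 / 4 * hausdorffDist (range Φ) (range Ψ) := by
  have : CompactSpace X := isCompact_iff_compactSpace.1 hXc
  have : CompactSpace Y := isCompact_iff_compactSpace.1 hYc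
  have : Nonempty X := hXn.to_subtype
  have : Nonempty Y := hYn.to_subtype
  have hcX := isCompact_range hΦ.continuous
  have hcY := isCompact_range hΨ.continuous
  obtain ⟨δ, hd⟩ : ∃ δ, hausdorffDist (range Φ) (range Ψ) = δ := ⟨_, rfl⟩
  have hδ : 0 ≤ δ := hd ▸ hausdorffDist_nonneg
  have hX : ∀ a : X, ∃ b : Y, dist (Φ a) (Ψ b) ≤ δ := fun a => by
    obtain ⟨_, ⟨b, rfl⟩, hb⟩ :=
      exists_dist_le_hausdorffDist hcX hcY (range_nonempty Ψ) (mem_range_self a)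
    exact ⟨b, hb.trans_eq hd⟩
  have hY : ∀ b : Y, ∃ a : X, dist (Φ a) (Ψ b) ≤ δ := fun b => by
    obtain ⟨_, ⟨a, rfl⟩, ha⟩ :=
      exists_dist_le_hausdorffDist hcY hcX (range_nonempty Φ) (mem_range_self b)
    exact ⟨a, by rwa [dist_comm, ← hd, hausdorffDist_comm]⟩
  let C := {p : X × Y // dist (Φ p.1) (Ψ p.2) ≤ δ}
  have hrX : range (fun p : C => (p.1.1 : ℝ)) = X := by
    ext a
    refine ⟨?_, fun ha => ?_⟩
    · rintro ⟨p, rfl⟩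
      exact p.1.1.2
    · obtain ⟨b, hb⟩ := hX ⟨a, ha⟩
      exact ⟨⟨(⟨a, ha⟩, b), hb⟩, rfl⟩
  have hrY : range (fun p : C => (p.1.2 : ℝ)) = Y := by
    ext b
    refine ⟨?_, fun hb => ?_⟩
    · rintro ⟨p, rfl⟩
      exact p.1.2.2
    · obtain ⟨a, ha⟩ := hY ⟨b, hb⟩
      exact ⟨⟨(a, ⟨b, hb⟩), ha⟩, rfl⟩
  have hclosed : IsClosed {p : X × Y | dist (Φ p.1) (Ψ p.2) ≤ δ} :=
    isClosed_le ((hΦ.continuous.comp continuous_fst).dist (hΨ.continuous.comp continuous_snd))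
      continuous_const
  have : CompactSpace C := isCompact_iff_compactSpace.1 hclosed.isCompact
  have : Nonempty C := by
    obtain ⟨a⟩ := ‹Nonempty X›
    obtain ⟨b, hb⟩ := hX a
    exact ⟨⟨(a, b), hb⟩⟩
  rw [hd]
  have hρ : 0 ≤ 5 / 4 * δ := by positivity
  have hpc : PairwiseClose (fun p : C => ((p.1.1 : ℝ) + p.1.2) / 2)
      (fun p : C => ((p.1.1 : ℝ) - p.1.2) / 2) δ := pairwiseClose_of_isometry hΦ hΨ δ
  rcases hpc.shiftMatched_or (by fun_prop) (by fun_prop) hδ with h | h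
  · exact h.hausdorffIsoDist_le hρ hrX hrY (s := 1) (fun t => by rw [one_mul])
      (fun p => by ring) (fun p => by ring)
  -- With the coordinates exchanged the difference is -y, so the isometry reverses orientation.
  · exact h.hausdorffIsoDist_le hρ hrX hrY (s := -1) (fun t => by rw [neg_one_mul, abs_neg])
      (fun p => by ring) (fun p => by ring)

theorem theorem1 (X Y : TopologicalSpace.NonemptyCompacts ℝ) :
    hausdorffIsoDist (X : Set ℝ) (Y : Set ℝ) ≤ 5 / 4 * GromovHausdorff.ghDist X Y := by
  obtain ⟨Φ, Ψ, hΦ, hΨ, hd⟩ := GromovHausdorff.ghDist_eq_hausdorffDist X Y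
  rw [hd]
  exact hausdorffIsoDist_le_of_isometry_hausdorffDist X.isCompact Y.isCompact X.nonempty
    Y.nonempty hΦ hΨ
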